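/- \textbf{Notation.} Let $\mathcal F$ be the set of all finite or infinite sequences of positive integers (including the empty one), totally ordered by: $(a_i)<(b_i)$ if $(a_i)$ is a proper initial segment of $(b_i)$, or if there is $\ell$ with $a_i=b_i$ for $i<\ell$ and $a_\ell>b_\ell$. Give $\mathcal F$ the order topology, and let $\mathcal F^*$ be $\mathcal F$ with the opposite order. Let $\Lambda$ be an artin algebra; modules are finitely generated, and $|\cdot|$ denotes length. The Gabriel--Roiter measure $\mu(M)\in\mathcal F$ is the supremum in $\mathcal F$ of the sequences $(|M_i/M_{i-1}|)_{i\ge 1}$, taken over all (finite or infinite) chains of submodules $0=M_0\subsetneq M_1\subsetneq\cdots$ of $M$ in which every $M_i$ with $i>0$ is indecomposable of finite length. The comeasure $\mu^*(M)\in\mathcal F^*$ is the infimum in $\mathcal F^*$ of the sequences $(|M_{i-1}/M_i|)_{i\ge 1}$, taken over all (finite or infinite) chains of submodules $\cdots\subsetneq M_1\subsetneq M_0=M$ in which every $M/M_i$ with $i>0$ is indecomposable of finite length. The rhombic picture is $\mathcal F\times\mathcal F^*$ with the product topology; $M$ has the coordinates $\rho(M)=(\mu(M),\mu^*(M))$.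 A stable tube is a connected component of the Auslander--Reiten quiver of $\Lambda$ that is isomorphic, as a valued translation quiver with trivial valuation, to $\mathbb Z\mathbb A_\infty/\langle\tau^n\rangle$ for some $n\ge 1$. The latter has vertices $(i,j)$ with $i\in\mathbb Z/n$, $j\ge 0$, arrows $(i,j)\to(i,j+1)$ and $(i,j+1)\to(i+1,j)$, and translation $\tau(i,j)=(i-1,j)$. The ray through $(i,j)$ is $(i,0)\to(i,1)\to(i,2)\to\cdots$, and the coray through $(i,j)$ is $\cdots\to(i+j-1,1)\to(i+j,0)$. The family $(M_k)_{k\ge 1}$ of an indecomposable module $M$ in the tube consists of the modules on the intersection of the ray and the coray through $M$, ordered by increasing length; the rhombic limit of $M$ is $\vec\rho(M)=\lim_{k\to\infty}\rho(M_k)$. \textbf{Theorem.} Let $0\to A\to B_1\oplus B_2\to C\to 0$ be an Auslander--Reiten sequence in a stable tube, where $B_1$ and $B_2$ are indecomposable. Then the rhombic limits of $A,B_1,B_2,C$ exist and form a possibly degenerate parallelogram in the rhombic picture, with vertices $\vec\rho(A),\vec\rho(B_1),\vec\rho(C),\vec\rho(B_2)$ in this cyclic order, whose nondegenerate sides are parallel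 to the $\mu$ and $\mu^*$ axes: of the two pairs of opposite sides $\{\vec\rho(A)\vec\rho(B_1),\ \vec\rho(B_2)\vec\rho(C)\}$ and $\{\vec\rho(A)\vec\rho(B_2),\ \vec\rho(B_1)\vec\rho(C)\}$, in one pair each side has endpoints with equal $\mu$-coordinates, and in the other pair each side has endpoints with equal $\mu^*$-coordinates. -/

import Mathlib

universe u

namespace RhombicTube

/-! ### The totally ordered set of sequences -/

/-- Finite or infinite sequences of positive integers. `entry i` is the term number `i`
(counted from `0`), and `none` if the sequence has at most `i` terms. The empty sequence
is included. -/
@[ext]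
structure GRSeq where
  entry : ℕ → Option ℕ+
  entry_succ : ∀ i, entry i = none → entry (i + 1) = none

namespace GRSeq

/-- `a` is an initial segment of `b` (possibly `b` itself). -/
def IsInitialSegment (a b : GRSeq) : Prop :=
  ∀ i, a.entry i = none ∨ a.entry i = b.entry i

/-- `a < b` if `a` is a proper initial segment of `b`, or if at the first place where the two
sequences differ, both have a term there and the term of `a` is the larger one. -/
instance : LT GRSeq where
  lt a b := (a.IsInitialSegment b ∧ a ≠ b) ∨
    ∃ l, (∀ i, i < l → a.entry i = b.entry i) ∧
      ∃ m n : ℕ+, a.entry l = some m ∧ b.entry l = some n ∧ n < m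

instance : LE GRSeq where
  le a b := a = b ∨ a < b

/-- Comparison of single entries: `none` is smallest, larger numbers are smaller. -/
def EntryLT (x y : Option ℕ+) : Prop :=
  (x = none ∧ y ≠ none) ∨ ∃ m n : ℕ+, x = some m ∧ y = some n ∧ n < m

theorem entryLT_trans {x y z : Option ℕ+} (h : EntryLT x y) (h' : EntryLT y z) :
    EntryLT x z := by
  rcases x with _ | x <;> rcases y with _ | y <;> rcases z with _ | z <;>
    simp [EntryLT] at h h' ⊢
  exact h'.trans h

theorem entryLT_irrefl (x : Option ℕ+) : ¬ EntryLT x x := by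
  rcases x with _ | x <;> simp [EntryLT]

theorem entryLT_trichotomy (x y : Option ℕ+) : EntryLT x y ∨ x = y ∨ EntryLT y x := by
  rcases x with _ | x <;> rcases y with _ | y <;> simp [EntryLT]
  rcases lt_trichotomy x y with h | h | h <;> simp [h]

theorem entry_none_of_le (a : GRSeq) {i j : ℕ} (hij : i ≤ j) (h : a.entry i = none) :
    a.entry j = none := by
  induction hij with
  | refl => exact h
  | step _ ih => exact a.entry_succ _ ih

theorem exists_first_diff {a b : GRSeq} (h : a ≠ b) :
    ∃ l, (∀ i, i < l → a.entry i = b.entry i) ∧ a.entry l ≠ b.entry l := by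
  classical
  have hex : ∃ l, a.entry l ≠ b.entry l := by
    by_contra! hc
    exact h (GRSeq.ext (funext hc))
  refine ⟨Nat.find hex, fun i hi => ?_, Nat.find_spec hex⟩
  by_contra hc
  exact Nat.find_min hex hi hc

/-- The order compares the entries at the first place of difference. -/
theorem lt_iff (a b : GRSeq) :
    a < b ↔ ∃ l, (∀ i, i < l → a.entry i = b.entry i) ∧
      EntryLT (a.entry l) (b.entry l) := by
  constructor
  · rintro (⟨h, hne⟩ | ⟨l, h, m, n, hm, hn, hlt⟩)
    · obtain ⟨l, h1, h2⟩ := exists_first_diff hne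
      refine ⟨l, h1, Or.inl ?_⟩
      rcases h l with h3 | h3
      · exact ⟨h3, fun h4 => h2 (h3.trans h4.symm)⟩
      · exact absurd h3 h2
    · exact ⟨l, h, Or.inr ⟨m, n, hm, hn, hlt⟩⟩
  · rintro ⟨l, h, ⟨h1, h2⟩ | ⟨m, n, hm, hn, hlt⟩⟩
    · refine Or.inl ⟨fun i => ?_, fun hab => h2 (by rw [← hab]; exact h1)⟩
      rcases lt_or_ge i l with hi | hi
      · exact Or.inr (h i hi)
      · exact Or.inl (a.entry_none_of_le hi h1)
    · exact Or.inr ⟨l, h, m, n, hm, hn, hlt⟩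

theorem lt_trans' {a b c : GRSeq} (h : a < b) (h' : b < c) : a < c := by
  rw [lt_iff] at *
  obtain ⟨l, h1, h2⟩ := h
  obtain ⟨m, h3, h4⟩ := h'
  rcases lt_trichotomy l m with hlm | hlm | hlm
  · exact ⟨l, fun i hi => (h1 i hi).trans (h3 i (hi.trans hlm)), h3 l hlm ▸ h2⟩
  · subst hlm
    exact ⟨l, fun i hi => (h1 i hi).trans (h3 i hi), entryLT_trans h2 h4⟩
  · exact ⟨m, fun i hi => (h1 i (hi.trans hlm)).trans (h3 i hi), (h1 m hlm).symm ▸ h4⟩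

theorem lt_irrefl' (a : GRSeq) : ¬ a < a := by
  rw [lt_iff]
  rintro ⟨l, _, h⟩
  exact entryLT_irrefl _ h

theorem lt_trichotomy' (a b : GRSeq) : a < b ∨ a = b ∨ b < a := by
  by_cases h : a = b
  · exact Or.inr (Or.inl h)
  · obtain ⟨l, h1, h2⟩ := exists_first_diff h
    rcases entryLT_trichotomy (a.entry l) (b.entry l) with h3 | h3 | h3
    · exact Or.inl ((lt_iff a b).2 ⟨l, h1, h3⟩)
    · exact absurd h3 h2
    · exact Or.inr (Or.inr ((lt_iff b a).2 ⟨l, fun i hi => (h1 i hi).symm, h3⟩))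

noncomputable instance : LinearOrder GRSeq where
  le_refl a := Or.inl rfl
  le_trans a b c := by
    rintro (rfl | h) (rfl | h')
    · exact Or.inl rfl
    · exact Or.inr h'
    · exact Or.inr h
    · exact Or.inr (lt_trans' h h')
  lt_iff_le_not_ge a b := by
    constructor
    · intro h
      refine ⟨Or.inr h, ?_⟩
      rintro (rfl | h')
      · exact lt_irrefl' _ h
      · exact lt_irrefl' _ (lt_trans' h h')
    · rintro ⟨rfl | h, h'⟩
      · exact absurd (Or.inl rfl) h'
      · exact h
  le_antisymm a b := by
    rintro (rfl | h) (h' | h')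
    · rfl
    · rfl
    · exact h'.symm
    · exact absurd (lt_trans' h h') (lt_irrefl' _)
  le_total a b := by
    rcases lt_trichotomy' a b with h | h | h
    · exact Or.inl (Or.inr h)
    · exact Or.inl (Or.inl h)
    · exact Or.inr (Or.inr h)
  toDecidableLE := Classical.decRel _

/-- The order topology. With it the set of sequences is a compact metrizable space. -/
noncomputable instance : TopologicalSpace GRSeq := Preorder.topology GRSeq

instance : OrderTopology GRSeq := ⟨rfl⟩

theorem exists_max_entry (E : Set (Option ℕ+)) (hE : E.Nonempty) :
    ∃ x ∈ E, ∀ y ∈ E, y = x ∨ EntryLT y x := by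
  classical
  by_cases h : ∃ n : ℕ+, some n ∈ E
  · refine ⟨some (PNat.find h), PNat.find_spec h, ?_⟩
    rintro (_ | n) hn
    · exact Or.inr (Or.inl ⟨rfl, by simp⟩)
    · rcases (PNat.find_min' h hn).lt_or_eq with hlt | heq
      · exact Or.inr (Or.inr ⟨n, PNat.find h, rfl, rfl, hlt⟩)
      · exact Or.inl (by rw [heq])
  · obtain ⟨x, hx⟩ := hE
    have hall : ∀ y ∈ E, y = none := by
      rintro (_ | n) hn
      · rfl
      · exact absurd ⟨n, hn⟩ h
    exact ⟨x, hx, fun y hy => Or.inl ((hall y hy).trans (hall x hx).symm)⟩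

/-- Every set of sequences has a supremum. -/
theorem exists_isLUB (S : Set GRSeq) : ∃ b, IsLUB S b := by
  classical
  rcases S.eq_empty_or_nonempty with rfl | hS
  · refine ⟨⟨fun _ => none, fun _ _ => rfl⟩, by simp, fun c _ => ?_⟩
    by_cases h : (⟨fun _ => none, fun _ _ => rfl⟩ : GRSeq) = c
    · exact Or.inl h
    · exact Or.inr (Or.inl ⟨fun _ => Or.inl rfl, h⟩)
  -- choose the largest possible entry again and again
  let mx : {T : Set GRSeq // T.Nonempty} → ℕ → Option ℕ+ := fun T i =>
    (exists_max_entry ((fun a => a.entry i) '' T.1) (T.2.image _)).choose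
  have hmx : ∀ T i, mx T i ∈ ((fun a : GRSeq => a.entry i) '' T.1) ∧
      ∀ y ∈ ((fun a : GRSeq => a.entry i) '' T.1), y = mx T i ∨ EntryLT y (mx T i) :=
    fun T i => (exists_max_entry ((fun a => a.entry i) '' T.1) (T.2.image _)).choose_spec
  let R : ℕ → {T : Set GRSeq // T.Nonempty} := fun i => Nat.rec ⟨S, hS⟩
    (fun i T => ⟨{a ∈ T.1 | a.entry i = mx T i}, (hmx T i).1.imp fun a ha => ⟨ha.1, ha.2⟩⟩) i
  have hR : ∀ i a, a ∈ (R (i + 1)).1 ↔ a ∈ (R i).1 ∧ a.entry i = mx (R i) i :=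
    fun i a => Iff.rfl
  have hRS : ∀ i a, a ∈ (R i).1 ↔ a ∈ S ∧ ∀ j, j < i → a.entry j = mx (R j) j := by
    intro i a
    induction i with
    | zero => simp [R]
    | succ i ih =>
      rw [hR, ih, and_assoc]
      refine and_congr_right fun _ => ⟨fun h j hj => ?_, fun h =>
        ⟨fun j hj => h j (hj.trans (Nat.lt_succ_self i)), h i (Nat.lt_succ_self i)⟩⟩
      rcases Nat.lt_succ_iff_lt_or_eq.1 hj with h' | rfl
      · exact h.1 j h'
      · exact h.2
  let b : GRSeq := ⟨fun i => mx (R i) i, fun i hi => by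
    obtain ⟨a, ha⟩ := (R (i + 2)).2
    have h1 := ((hRS (i + 2) a).1 ha).2 i (by omega)
    have h2 := ((hRS (i + 2) a).1 ha).2 (i + 1) (by omega)
    exact h2.symm.trans (a.entry_succ i (h1.trans hi))⟩
  refine ⟨b, fun a ha => ?_, fun c hc => ?_⟩
  · by_cases hab : a = b
    · exact Or.inl hab
    · obtain ⟨l, h1, h2⟩ := exists_first_diff hab
      have haR : a ∈ (R l).1 := (hRS l a).2 ⟨ha, h1⟩
      rcases (hmx (R l) l).2 _ ⟨a, haR, rfl⟩ with h | h
      · exact absurd h h2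
      · exact Or.inr ((lt_iff a b).2 ⟨l, h1, h⟩)
  · by_contra hcb
    obtain ⟨l, h1, h2⟩ := (lt_iff c b).1 (not_le.1 hcb)
    obtain ⟨a, ha⟩ := (R (l + 1)).2
    obtain ⟨haS, ha'⟩ := (hRS (l + 1) a).1 ha
    have hca : c < a := (lt_iff c a).2 ⟨l, fun i hi => (h1 i hi).trans (ha' i (by omega)).symm,
      by rw [ha' l (by omega)]; exact h2⟩
    exact absurd (hc haS) (not_le.2 hca)

noncomputable instance : SupSet GRSeq where
  sSup S := (exists_isLUB S).choose

theorem isLUB_sSup (S : Set GRSeq) : IsLUB S (sSup S) :=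
  (exists_isLUB S).choose_spec

end GRSeq

/-! ### Modules: indecomposability, Gabriel-Roiter measure and comeasure -/

section Modules

variable (Λ : Type u) [Ring Λ]

/-- A module is indecomposable if it is nonzero and is not the direct sum of two nonzero
submodules. -/
def IsIndecomposable (M : Type u) [AddCommGroup M] [Module Λ M] : Prop :=
  Nontrivial M ∧ ∀ p q : Submodule Λ M, IsCompl p q → p = ⊥ ∨ q = ⊥

/-- `a` is the sequence of lengths `|Mᵢ/Mᵢ₋₁|` of a (finite or infinite) chain
`0 = M₀ ⊊ M₁ ⊊ ⋯` of submodules of `M` in which each `Mᵢ`, `i > 0`, is indecomposable of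
finite length. The submodules `N i` with index beyond the end of `a` play no role. -/
def IsFiltrationSeq (M : Type u) [AddCommGroup M] [Module Λ M] (a : GRSeq) : Prop :=
  ∃ N : ℕ → Submodule Λ M, N 0 = ⊥ ∧
    ∀ (i : ℕ) (d : ℕ+), a.entry i = some d →
      N i < N (i + 1) ∧ IsIndecomposable Λ (N (i + 1)) ∧ IsFiniteLength Λ (N (i + 1)) ∧
        Module.length Λ (N (i + 1) ⧸ (N i).submoduleOf (N (i + 1))) = ((d : ℕ) : ℕ∞)

/-- `a` is the sequence of lengths `|Mᵢ₋₁/Mᵢ|` of a (finite or infinite) chain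
`⋯ ⊊ M₁ ⊊ M₀ = M` of submodules of `M` in which each factor `M/Mᵢ`, `i > 0`, is
indecomposable of finite length. -/
def IsCofiltrationSeq (M : Type u) [AddCommGroup M] [Module Λ M] (a : GRSeq) : Prop :=
  ∃ N : ℕ → Submodule Λ M, N 0 = ⊤ ∧
    ∀ (i : ℕ) (d : ℕ+), a.entry i = some d →
      N (i + 1) < N i ∧ IsIndecomposable Λ (M ⧸ N (i + 1)) ∧
        IsFiniteLength Λ (M ⧸ N (i + 1)) ∧
        Module.length Λ (N i ⧸ (N (i + 1)).submoduleOf (N i)) = ((d : ℕ) : ℕ∞)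

/-- The Gabriel-Roiter measure. -/
noncomputable def grMeasure (M : Type u) [AddCommGroup M] [Module Λ M] : GRSeq :=
  sSup {a : GRSeq | IsFiltrationSeq Λ M a}

/-- The Gabriel-Roiter comeasure, an infimum in the set of sequences with the opposite
order. -/
noncomputable def grComeasure (M : Type u) [AddCommGroup M] [Module Λ M] : GRSeqᵒᵈ :=
  sInf {a : GRSeqᵒᵈ | IsCofiltrationSeq Λ M (OrderDual.ofDual a)}

end Modules

/-! ### Almost split sequences and irreducible maps -/

section Maps

variable {Λ : Type u} [Ring Λ]
variable {A : Type u} [AddCommGroup A] [Module Λ A]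
variable {B : Type u} [AddCommGroup B] [Module Λ B]
variable {C : Type u} [AddCommGroup C] [Module Λ C]

def IsSplitMono (f : A →ₗ[Λ] B) : Prop := ∃ r : B →ₗ[Λ] A, r ∘ₗ f = LinearMap.id

def IsSplitEpi (g : B →ₗ[Λ] C) : Prop := ∃ s : C →ₗ[Λ] B, g ∘ₗ s = LinearMap.id

/-- Irreducible maps in the category of finitely generated modules. -/
def IsIrreducibleMap (f : A →ₗ[Λ] B) : Prop :=
  ¬ IsSplitMono f ∧ ¬ IsSplitEpi f ∧
    ∀ (Z : Type u) [AddCommGroup Z] [Module Λ Z] [Module.Finite Λ Z]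
      (g : A →ₗ[Λ] Z) (h : Z →ₗ[Λ] B), f = h ∘ₗ g → IsSplitMono g ∨ IsSplitEpi h

def IsLeftAlmostSplit (f : A →ₗ[Λ] B) : Prop :=
  ¬ IsSplitMono f ∧
    ∀ (Z : Type u) [AddCommGroup Z] [Module Λ Z] [Module.Finite Λ Z] (t : A →ₗ[Λ] Z),
      ¬ IsSplitMono t → ∃ t' : B →ₗ[Λ] Z, t' ∘ₗ f = t

def IsRightAlmostSplit (g : B →ₗ[Λ] C) : Prop :=
  ¬ IsSplitEpi g ∧
    ∀ (Z : Type u) [AddCommGroup Z] [Module Λ Z] [Module.Finite Λ Z] (t : Z →ₗ[Λ] C),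
      ¬ IsSplitEpi t → ∃ t' : Z →ₗ[Λ] B, g ∘ₗ t' = t

def IsLeftMinimal (f : A →ₗ[Λ] B) : Prop :=
  ∀ h : B →ₗ[Λ] B, h ∘ₗ f = f → Function.Bijective h

def IsRightMinimal (g : B →ₗ[Λ] C) : Prop :=
  ∀ h : B →ₗ[Λ] B, g ∘ₗ h = g → Function.Bijective h

/-- `0 → A → B → C → 0` is an Auslander-Reiten (almost split) sequence. -/
structure IsARSequence (f : A →ₗ[Λ] B) (g : B →ₗ[Λ] C) : Prop where
  injective : Function.Injective f
  exact : Function.Exact f g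
  surjective : Function.Surjective g
  left_almost_split : IsLeftAlmostSplit f
  right_almost_split : IsRightAlmostSplit g

end Maps

/-! ### The Auslander-Reiten quiver and its stable tubes -/

/-- Finitely generated indecomposable modules. Their isomorphism classes are the vertices
of the Auslander-Reiten quiver; we work with representatives. -/
structure IndecMod (Λ : Type u) [Ring Λ] where
  carrier : Type u
  [addCommGroup : AddCommGroup carrier]
  [module : Module Λ carrier]
  [finite : Module.Finite Λ carrier]
  indecomposable : IsIndecomposable Λ carrier

attribute [instance] IndecMod.addCommGroup IndecMod.module IndecMod.finite

section Quiver

variable {Λ : Type u} [Ring Λ]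

instance : CoeSort (IndecMod Λ) (Type u) := ⟨IndecMod.carrier⟩

namespace IndecMod

/-- Equality of vertices: isomorphism of modules. -/
def Iso (X Y : IndecMod Λ) : Prop := Nonempty (X ≃ₗ[Λ] Y)

/-- There is an arrow from `X` to `Y` if there is an irreducible map from `X` to `Y`. -/
def Arrow (X Y : IndecMod Λ) : Prop := ∃ f : X →ₗ[Λ] Y, IsIrreducibleMap f

/-- The translation: `X = τ Y` if there is an Auslander-Reiten sequence that starts in `X`
and ends in `Y`. -/
def IsTranslate (X Y : IndecMod Λ) : Prop :=
  ∃ (B : Type u) (_ : AddCommGroup B) (_ : Module Λ B) (f : X →ₗ[Λ] B) (g : B →ₗ[Λ] Y),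
    IsARSequence f g

/-- `X` is not isomorphic to a direct summand of `Z`. -/
def NotSummand (X : IndecMod Λ) (Z : Type u) [AddCommGroup Z] [Module Λ Z] : Prop :=
  ¬ ∃ i : X →ₗ[Λ] Z, IsSplitMono i

/-- The valuation `(a, b)` of an arrow from `X` to `Y`: there are a minimal right almost split
map `Xᵃ ⊕ Z → Y`, with `X` not a summand of `Z`, and a minimal left almost split map
`X → Yᵇ ⊕ W`, with `Y` not a summand of `W`. -/
def HasValuation (X Y : IndecMod Λ) (a b : ℕ) : Prop :=
  (∃ (Z : Type u) (_ : AddCommGroup Z) (_ : Module Λ Z) (_ : Module.Finite Λ Z)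
    (g : ((Fin a → X) × Z) →ₗ[Λ] Y),
      X.NotSummand Z ∧ IsRightMinimal g ∧ IsRightAlmostSplit g) ∧
  (∃ (W : Type u) (_ : AddCommGroup W) (_ : Module Λ W) (_ : Module.Finite Λ W)
    (f : X →ₗ[Λ] ((Fin b → Y) × W)),
      Y.NotSummand W ∧ IsLeftMinimal f ∧ IsLeftAlmostSplit f)

/-- `X` and `Y` lie in the same connected component of the Auslander-Reiten quiver. -/
def SameComponent : IndecMod Λ → IndecMod Λ → Prop :=
  Relation.EqvGen fun X Y => X.Iso Y ∨ X.Arrow Y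

end IndecMod

/-- Vertices of the translation quiver `ℤA_∞/⟨τⁿ⟩`. The vertex `(i, j)` has quasi-length
`j + 1`, so the vertices `(i, 0)` are the quasi-simple ones. -/
abbrev TubeVertex (n : ℕ) : Type := ZMod n × ℕ

/-- Arrows of `ℤA_∞/⟨τⁿ⟩`: `(i, j) → (i, j + 1)` and `(i, j + 1) → (i + 1, j)`. -/
def TubeVertex.Arrow {n : ℕ} (p q : TubeVertex n) : Prop :=
  q = (p.1, p.2 + 1) ∨ (q.1 = p.1 + 1 ∧ p.2 = q.2 + 1)

/-- The translation of `ℤA_∞/⟨τⁿ⟩`: `τ (i, j) = (i - 1, j)`. -/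
def TubeVertex.translate {n : ℕ} (p : TubeVertex n) : TubeVertex n := (p.1 - 1, p.2)

/-- The ray `(i, 0) → (i, 1) → (i, 2) → ⋯` through a vertex. -/
def TubeVertex.ray {n : ℕ} (p : TubeVertex n) : Set (TubeVertex n) :=
  {q | q.1 = p.1}

/-- The coray `⋯ → (k - 2, 2) → (k - 1, 1) → (k, 0)` through a vertex. -/
def TubeVertex.coray {n : ℕ} (p : TubeVertex n) : Set (TubeVertex n) :=
  {q | q.1 + (q.2 : ZMod n) = p.1 + (p.2 : ZMod n)}

variable (Λ) in
/-- A stable tube: a connected component of the Auslander-Reiten quiver that is isomorphic,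
as a valued translation quiver, to `ℤA_∞/⟨τⁿ⟩` (with trivial valuation) for some `n ≥ 1`. -/
structure StableTube where
  rank : ℕ
  rank_pos : 0 < rank
  obj : TubeVertex rank → IndecMod Λ
  obj_injective : ∀ p q, (obj p).Iso (obj q) → p = q
  component : ∀ Y : IndecMod Λ,
    (obj (0, 0)).SameComponent Y ↔ ∃ p, Y.Iso (obj p)
  arrow_iff : ∀ p q, (obj p).Arrow (obj q) ↔ p.Arrow q
  valuation : ∀ p q, p.Arrow q → (obj p).HasValuation (obj q) 1 1
  translate_iff : ∀ p q, (obj p).IsTranslate (obj q) ↔ p = q.translate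

/-- The module `M` lies in the tube `T`. -/
def StableTube.Mem (T : StableTube Λ) (M : IndecMod Λ) : Prop := ∃ p, M.Iso (T.obj p)

/-- `s` lists the family of the module at the vertex `p`, that is, the modules on the
intersection of the ray and the coray through `p`, in the order of increasing length. -/
def StableTube.IsFamily (T : StableTube Λ) (p : TubeVertex T.rank)
    (s : ℕ → TubeVertex T.rank) : Prop :=
  Set.range s = p.ray ∩ p.coray ∧
    StrictMono fun k => Module.length Λ (T.obj (s k))

/-- The rhombic limit of `M` exists and is equal to `x`: the points with coordinates
the measure and the comeasure of the members of the family of `M` converge to `x`. -/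
def StableTube.IsRhombicLimit (T : StableTube Λ) (M : IndecMod Λ)
    (x : GRSeq × GRSeqᵒᵈ) : Prop :=
  ∃ (p : TubeVertex T.rank) (s : ℕ → TubeVertex T.rank),
    M.Iso (T.obj p) ∧ T.IsFamily p s ∧
      Filter.Tendsto (fun k => (grMeasure Λ (T.obj (s k)), grComeasure Λ (T.obj (s k))))
        Filter.atTop (nhds x)

end Quiver

/-- The points `a`, `b₁`, `c`, `b₂`, in this cyclic order, are the vertices of a (possibly
degenerate) parallelogram with sides parallel to the two axes: of the two pairs of opposite
sides `{a b₁, b₂ c}` and `{a b₂, b₁ c}`, one consists of sides on which the first coordinate is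
constant, and the other one of sides on which the second coordinate is constant. -/
def IsAxisParallelogram {P Q : Type*} (a b₁ b₂ c : P × Q) : Prop :=
  ((a.1 = b₁.1 ∧ b₂.1 = c.1) ∧ (a.2 = b₂.2 ∧ b₁.2 = c.2)) ∨
  ((a.1 = b₂.1 ∧ b₁.1 = c.1) ∧ (a.2 = b₁.2 ∧ b₂.2 = c.2))

end RhombicTube

/-!
In a stable tube every arrow `(i, j) → (i, j + 1)` of a ray is represented by a monomorphism and
every arrow `(i, j + 1) → (i + 1, j)` of a coray by an epimorphism. The Gabriel-Roiter measure
grows along monomorphisms, so along a ray it increases to a supremum that depends only on the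
ray. In the opposite order the comeasure decreases under passage to larger modules along a coray,
so there it tends to an infimum that depends only on the coray. The family of `(i, j)` is cofinal
in the ray and in the coray through `(i, j)`, so rhombic limits exist, and their two coordinates
are these two limits (`StableTube.isRhombicLimit`). The parallelogram is then read off from the
mesh: an almost split sequence starting in `(i, j)` ends in `(i + 1, j)` and has the middle terms
`(i, j + 1)` and `(i + 1, j - 1)`, which lie two by two on common rays and common corays
(`StableTube.exists_vertices_of_isARSequence`).

Irreducible maps are injective or surjective, so the statement on arrows amounts to a comparison
of lengths (`StableTube.len_lt_len`). It follows by induction on `j`, since lengths are additive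
on almost split sequences and the middle term is known (`StableTube.exists_len_eq`). To identify
the middle terms one uses that the maps in an almost split sequence are minimal
(`IsARSequence.isRightMinimal`, by Fitting's lemma), that nonzero summands of the middle term
are connected with the ends by irreducible maps, and that, the valuation being trivial,
multiplicities are one (`StableTube.not_isSplitMono_prod_of_arrow`, by a special case of the
Krull-Remak-Schmidt theorem).
-/

namespace RhombicTube

/-! ### Monotonicity of the measure and the comeasure -/

section Measure

variable {Λ : Type u} [Ring Λ]
variable {M : Type u} [AddCommGroup M] [Module Λ M]
variable {N : Type u} [AddCommGroup N] [Module Λ N]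

theorem IsIndecomposable.of_linearEquiv (h : IsIndecomposable Λ M) (e : M ≃ₗ[Λ] N) :
    IsIndecomposable Λ N := by
  have := h.1
  refine ⟨e.symm.toEquiv.nontrivial, fun p q hpq => ?_⟩
  rcases h.2 _ _ ((Submodule.orderIsoMapComap e.symm).isCompl hpq) with h' | h'
  · left
    simpa using h'
  · right
    simpa using h'

/-- The third isomorphism theorem in the form `M / φ⁻¹(p) ≃ N / p`. -/
noncomputable def quotientComapEquiv (φ : M →ₗ[Λ] N) (hφ : Function.Surjective φ)
    (p : Submodule Λ N) : (M ⧸ p.comap φ) ≃ₗ[Λ] N ⧸ p :=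
  (Submodule.quotEquivOfEq _ _ (by rw [LinearMap.ker_comp, Submodule.ker_mkQ])).trans
    ((p.mkQ ∘ₗ φ).quotKerEquivOfSurjective ((Submodule.mkQ_surjective p).comp hφ))

theorem IsFiltrationSeq.of_injective {a : GRSeq} (h : IsFiltrationSeq Λ M a) (φ : M →ₗ[Λ] N)
    (hφ : Function.Injective φ) : IsFiltrationSeq Λ N a := by
  obtain ⟨P, h0, hP⟩ := h
  refine ⟨fun i => (P i).map φ, by simp [h0], fun i d hd => ?_⟩
  obtain ⟨h1, h2, h3, h4⟩ := hP i d hd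
  have e := Submodule.equivMapOfInjective φ hφ (P (i + 1))
  refine ⟨Submodule.map_strictMono_of_injective hφ h1, h2.of_linearEquiv e,
    e.isFiniteLength h3, ?_⟩
  rw [← h4]
  refine (LinearEquiv.length_eq (Submodule.Quotient.equiv _ _
    (Submodule.equivMapOfInjective φ hφ (P (i + 1))) ?_)).symm
  ext ⟨y, hy⟩
  simp only [Submodule.mem_map, Submodule.submoduleOf, Submodule.mem_comap, Subtype.exists]
  constructor
  · rintro ⟨x, hx, hx', hxy⟩
    exact ⟨x, hx', congrArg Subtype.val hxy⟩
  · rintro ⟨x, hx', hxy⟩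
    exact ⟨x, h1.le hx', hx', Subtype.ext hxy⟩

theorem IsCofiltrationSeq.of_surjective {a : GRSeq} (h : IsCofiltrationSeq Λ N a)
    (φ : M →ₗ[Λ] N) (hφ : Function.Surjective φ) : IsCofiltrationSeq Λ M a := by
  obtain ⟨P, h0, hP⟩ := h
  refine ⟨fun i => (P i).comap φ, by simp [h0], fun i d hd => ?_⟩
  obtain ⟨h1, h2, h3, h4⟩ := hP i d hd
  have e := (quotientComapEquiv φ hφ (P (i + 1))).symm
  refine ⟨Submodule.comap_strictMono_of_surjective hφ h1, h2.of_linearEquiv e,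
    e.isFiniteLength h3, ?_⟩
  rw [← h4]
  have hψ : Function.Surjective (φ.restrict (p := (P i).comap φ) (q := P i) fun _ hx => hx) := by
    rintro ⟨y, hy⟩
    obtain ⟨x, rfl⟩ := hφ y
    exact ⟨⟨x, hy⟩, rfl⟩
  exact (quotientComapEquiv _ hψ ((P (i + 1)).submoduleOf (P i))).length_eq

theorem grMeasure_le_of_injective (φ : M →ₗ[Λ] N) (hφ : Function.Injective φ) :
    grMeasure Λ M ≤ grMeasure Λ N :=
  (GRSeq.isLUB_sSup _).mono (GRSeq.isLUB_sSup _) fun _ ha => ha.of_injective φ hφ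

theorem grComeasure_le_of_surjective (φ : M →ₗ[Λ] N) (hφ : Function.Surjective φ) :
    grComeasure Λ M ≤ grComeasure Λ N :=
  (GRSeq.isLUB_sSup {a | IsCofiltrationSeq Λ N a}).mono
    (GRSeq.isLUB_sSup {a | IsCofiltrationSeq Λ M a}) fun _ ha => ha.of_surjective φ hφ

end Measure

/-! ### Split maps and direct summands -/

section Split

variable {Λ : Type u} [Ring Λ]
variable {A : Type u} [AddCommGroup A] [Module Λ A]
variable {B : Type u} [AddCommGroup B] [Module Λ B]
variable {C : Type u} [AddCommGroup C] [Module Λ C]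
variable {D : Type u} [AddCommGroup D] [Module Λ D]

theorem IsSplitMono.comp {g : B →ₗ[Λ] C} {f : A →ₗ[Λ] B} (hg : IsSplitMono g)
    (hf : IsSplitMono f) : IsSplitMono (g ∘ₗ f) := by
  obtain ⟨r, hr⟩ := hg
  obtain ⟨s, hs⟩ := hf
  refine ⟨s ∘ₗ r, ?_⟩
  calc (s ∘ₗ r) ∘ₗ g ∘ₗ f = s ∘ₗ (r ∘ₗ g) ∘ₗ f := rfl
    _ = LinearMap.id := by rw [hr, LinearMap.id_comp, hs]

theorem IsSplitMono.of_comp {g : B →ₗ[Λ] C} {f : A →ₗ[Λ] B} (h : IsSplitMono (g ∘ₗ f)) :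
    IsSplitMono f :=
  h.imp' (fun r => r ∘ₗ g) fun _ hr => hr

theorem IsSplitEpi.of_comp {g : B →ₗ[Λ] C} {f : A →ₗ[Λ] B} (h : IsSplitEpi (g ∘ₗ f)) :
    IsSplitEpi g :=
  h.imp' (fun s => f ∘ₗ s) fun _ hs => hs

theorem IsSplitMono.injective {f : A →ₗ[Λ] B} (h : IsSplitMono f) : Function.Injective f := by
  obtain ⟨r, hr⟩ := h
  exact Function.LeftInverse.injective (g := r) fun x => LinearMap.congr_fun hr x

theorem IsSplitEpi.surjective {f : A →ₗ[Λ] B} (h : IsSplitEpi f) : Function.Surjective f := by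
  obtain ⟨s, hs⟩ := h
  exact Function.RightInverse.surjective (g := s) fun x => LinearMap.congr_fun hs x

theorem _root_.LinearEquiv.isSplitMono (e : A ≃ₗ[Λ] B) : IsSplitMono (e : A →ₗ[Λ] B) :=
  ⟨e.symm, by ext; simp⟩

theorem isSplitMono_inl : IsSplitMono (LinearMap.inl Λ A B) :=
  ⟨LinearMap.fst Λ A B, by ext; simp⟩

theorem isSplitMono_inr : IsSplitMono (LinearMap.inr Λ A B) :=
  ⟨LinearMap.snd Λ A B, by ext; simp⟩

theorem IsSplitMono.prodMap {f : A →ₗ[Λ] B} {g : C →ₗ[Λ] D} (hf : IsSplitMono f)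
    (hg : IsSplitMono g) : IsSplitMono (f.prodMap g) := by
  obtain ⟨r, hr⟩ := hf
  obtain ⟨s, hs⟩ := hg
  refine ⟨r.prodMap s, ?_⟩
  rw [LinearMap.prodMap_comp, hr, hs, LinearMap.prodMap_id]

theorem isSplitMono_of_bijective {f : A →ₗ[Λ] B} (h : Function.Bijective f) : IsSplitMono f :=
  (LinearEquiv.ofBijective f h).isSplitMono

theorem isSplitEpi_of_bijective {f : A →ₗ[Λ] B} (h : Function.Bijective f) : IsSplitEpi f :=
  ⟨(LinearEquiv.ofBijective f h).symm, by
    ext x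
    exact (LinearEquiv.ofBijective f h).apply_symm_apply x⟩

/-- If `r ∘ i = 1`, then the ambient module is the direct sum of the image of `i` and the
kernel of `r`. -/
theorem isCompl_range_ker_of_comp_eq_id {i : A →ₗ[Λ] B} {r : B →ₗ[Λ] A}
    (h : r ∘ₗ i = LinearMap.id) : IsCompl (LinearMap.range i) (LinearMap.ker r) := by
  have h' : ∀ x, r (i x) = x := LinearMap.congr_fun h
  constructor
  · rw [Submodule.disjoint_def]
    rintro _ ⟨x, rfl⟩ hx
    rw [LinearMap.mem_ker, h'] at hx
    simp [hx]
  · rw [codisjoint_iff, eq_top_iff]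
    intro x _
    rw [← add_sub_cancel (i (r x)) x]
    exact Submodule.add_mem_sup ⟨_, rfl⟩ (by simp [h'])

theorem IsSplitMono.bijective_of_isIndecomposable [Nontrivial A] {f : A →ₗ[Λ] B}
    (hf : IsSplitMono f) (hB : IsIndecomposable Λ B) : Function.Bijective f := by
  obtain ⟨r, hr⟩ := hf
  have hc := isCompl_range_ker_of_comp_eq_id hr
  refine ⟨IsSplitMono.injective ⟨r, hr⟩, ?_⟩
  rcases hB.2 _ _ hc with h | h
  · obtain ⟨x, hx⟩ := exists_ne (0 : A)
    have := LinearMap.congr_fun hr x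
    simp [LinearMap.range_eq_bot.1 h, hx.symm] at this
  · rw [h] at hc
    exact LinearMap.range_eq_top.1 (by simpa using hc.sup_eq_top)

theorem IsSplitEpi.bijective_of_isIndecomposable [Nontrivial B] {f : A →ₗ[Λ] B}
    (hf : IsSplitEpi f) (hA : IsIndecomposable Λ A) : Function.Bijective f := by
  obtain ⟨s, hs⟩ := hf
  have hb := IsSplitMono.bijective_of_isIndecomposable (f := s) ⟨f, hs⟩ hA
  refine ⟨fun x y hxy => ?_, IsSplitEpi.surjective ⟨s, hs⟩⟩
  obtain ⟨x, rfl⟩ := hb.2 x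
  obtain ⟨y, rfl⟩ := hb.2 y
  have h' : ∀ x, f (s x) = x := LinearMap.congr_fun hs
  rw [h', h'] at hxy
  rw [hxy]

/-- Fitting's lemma for indecomposable modules. -/
theorem IsIndecomposable.bijective_or_isNilpotent [IsNoetherian Λ A] [IsArtinian Λ A]
    (hA : IsIndecomposable Λ A) (φ : Module.End Λ A) :
    Function.Bijective φ ∨ IsNilpotent φ := by
  obtain ⟨n, hn⟩ := Filter.eventually_atTop.1 φ.eventually_isCompl_ker_pow_range_pow
  rcases hA.2 _ _ (hn (n + 1) (Nat.le_succ n)) with h | h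
  · left
    refine IsArtinian.bijective_of_injective_endomorphism φ (LinearMap.ker_eq_bot.1 ?_)
    rw [eq_bot_iff, ← h]
    intro x hx
    rw [LinearMap.mem_ker] at hx ⊢
    rw [pow_succ, Module.End.mul_apply, hx, map_zero]
  · exact Or.inr ⟨n + 1, LinearMap.range_eq_bot.1 h⟩

/-- The endomorphism ring of an indecomposable module of finite length is local: if the sum of
two endomorphisms is the identity, one of them is bijective. -/
theorem IsIndecomposable.bijective_or_bijective_of_add_eq_id [IsNoetherian Λ A]
    [IsArtinian Λ A] (hA : IsIndecomposable Λ A) {φ ψ : Module.End Λ A}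
    (h : φ + ψ = LinearMap.id) : Function.Bijective φ ∨ Function.Bijective ψ := by
  rcases hA.bijective_or_isNilpotent φ with h' | h'
  · exact Or.inl h'
  · right
    rw [← Module.End.isUnit_iff]
    have : ψ = 1 - φ := eq_sub_of_add_eq' h
    rw [this]
    exact h'.isUnit_one_sub

/-- A special case of the Krull-Remak-Schmidt theorem: if `W` is indecomposable and `W ⊕ W` is
a direct summand of `W ⊕ Z`, then `W` is a direct summand of `Z`. -/
theorem exists_isSplitMono_of_isSplitMono_prod [IsNoetherian Λ A] [IsArtinian Λ A]
    (hA : IsIndecomposable Λ A) {i : A × A →ₗ[Λ] A × B} (hi : IsSplitMono i) :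
    ∃ j : A →ₗ[Λ] B, IsSplitMono j := by
  obtain ⟨r, hr⟩ := hi
  by_contra hno
  have hr' : ∀ x, r (i x) = x := LinearMap.congr_fun hr
  have hsplit : ∀ x : A × B, r x = r (x.1, 0) + r (0, x.2) := fun x => by
    rw [← map_add]; simp
  -- an endomorphism of `A` that factors through `B` is not bijective
  have hnb : ∀ (s : A →ₗ[Λ] B) (t : B →ₗ[Λ] A), ¬ Function.Bijective (t ∘ₗ s) := fun s t h =>
    hno ⟨s, (isSplitMono_of_bijective h).of_comp⟩
  let i₁ := LinearMap.fst Λ A B ∘ₗ i ∘ₗ LinearMap.inl Λ A A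
  let i₂ := LinearMap.fst Λ A B ∘ₗ i ∘ₗ LinearMap.inr Λ A A
  let j₁ := LinearMap.snd Λ A B ∘ₗ i ∘ₗ LinearMap.inl Λ A A
  let j₂ := LinearMap.snd Λ A B ∘ₗ i ∘ₗ LinearMap.inr Λ A A
  let r₁ := LinearMap.fst Λ A A ∘ₗ r ∘ₗ LinearMap.inl Λ A B
  let r₂ := LinearMap.snd Λ A A ∘ₗ r ∘ₗ LinearMap.inl Λ A B
  let s₁ := LinearMap.fst Λ A A ∘ₗ r ∘ₗ LinearMap.inr Λ A B
  let s₂ := LinearMap.snd Λ A A ∘ₗ r ∘ₗ LinearMap.inr Λ A B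
  have h11 : r₁ ∘ₗ i₁ + s₁ ∘ₗ j₁ = LinearMap.id := by
    ext x
    have := congrArg Prod.fst ((hsplit (i (x, 0))).symm.trans (hr' (x, 0)))
    simpa [r₁, i₁, s₁, j₁] using this
  have h22 : r₂ ∘ₗ i₂ + s₂ ∘ₗ j₂ = LinearMap.id := by
    ext x
    have := congrArg Prod.snd ((hsplit (i (0, x))).symm.trans (hr' (0, x)))
    simpa [r₂, i₂, s₂, j₂] using this
  have h12 : r₁ ∘ₗ i₂ + s₁ ∘ₗ j₂ = 0 := by
    ext x
    have := congrArg Prod.fst ((hsplit (i (0, x))).symm.trans (hr' (0, x)))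
    simpa [r₁, i₂, s₁, j₂] using this
  -- the diagonal entries force `r₁` and `i₂` to be bijective, the entry `(1, 2)` forbids it
  have hb1 := (hA.bijective_or_bijective_of_add_eq_id h11).resolve_right (hnb _ _)
  have hb2 := (hA.bijective_or_bijective_of_add_eq_id h22).resolve_right (hnb _ _)
  have hr1 : Function.Bijective r₁ :=
    IsNoetherian.bijective_of_surjective_endomorphism r₁
      (Function.Surjective.of_comp (g := i₁) hb1.2)
  have hi2 : Function.Bijective i₂ :=
    IsArtinian.bijective_of_injective_endomorphism i₂
      (Function.Injective.of_comp (f := r₂) hb2.1)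
  refine hnb j₂ (-s₁) ?_
  have : (-s₁) ∘ₗ j₂ = r₁ ∘ₗ i₂ := by
    rw [LinearMap.neg_comp]
    exact (eq_neg_of_add_eq_zero_left h12).symm
  rw [this]
  exact hr1.comp hi2

/-- A nonzero module of finite length has an indecomposable direct summand. -/
theorem exists_isIndecomposable_isCompl [IsArtinian Λ A] [Nontrivial A] :
    ∃ p q : Submodule Λ A, IsCompl p q ∧ IsIndecomposable Λ p := by
  let S : Set (Submodule Λ A) := {p | p ≠ ⊥ ∧ ∃ q, IsCompl p q}
  obtain ⟨p, ⟨hp, q, hpq⟩, hmin⟩ := IsWellFounded.wf.has_min (r := (· < ·)) S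
    ⟨⊤, top_ne_bot, ⊥, isCompl_top_bot⟩
  refine ⟨p, q, hpq, Submodule.nontrivial_iff_ne_bot.2 hp, fun x y hxy => ?_⟩
  by_contra! hne
  obtain ⟨hx, hy⟩ := hne
  refine hmin (x.map p.subtype) ⟨?_, y.map p.subtype ⊔ q, ?_⟩ ?_
  · rwa [(Submodule.map_injective_of_injective p.injective_subtype).ne_iff' (Submodule.map_bot _)]
  · have hd : Disjoint (x.map p.subtype) (y.map p.subtype) :=
      Submodule.disjoint_map p.injective_subtype hxy.disjoint
    have hs : x.map p.subtype ⊔ y.map p.subtype = p := by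
      rw [← Submodule.map_sup, hxy.sup_eq_top, Submodule.map_subtype_top]
    refine ⟨hd.disjoint_sup_right_of_disjoint_sup_left (by rw [hs]; exact hpq.disjoint), ?_⟩
    rw [codisjoint_iff, ← sup_assoc, hs, hpq.sup_eq_top]
  · refine lt_of_le_of_ne (Submodule.map_subtype_le p x) fun h => hy ?_
    have hx' : x = ⊤ := by
      apply Submodule.map_injective_of_injective p.injective_subtype
      rw [h, Submodule.map_subtype_top]
    simpa [hx'] using hxy.inf_eq_bot

/-- If every indecomposable direct summand of `B` is isomorphic to `A`, and `A ⊕ A` is not a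
direct summand of `B`, then `B` is zero or isomorphic to `A`. -/
theorem subsingleton_or_nonempty_linearEquiv [IsArtinian Λ B]
    (h : ∀ p q : Submodule Λ B, IsCompl p q → IsIndecomposable Λ p → Nonempty (A ≃ₗ[Λ] p))
    (h2 : ¬ ∃ i : A × A →ₗ[Λ] B, IsSplitMono i) :
    Subsingleton B ∨ Nonempty (A ≃ₗ[Λ] B) := by
  rcases subsingleton_or_nontrivial B with hB | hB
  · exact Or.inl hB
  right
  obtain ⟨p, q, hpq, hp⟩ := exists_isIndecomposable_isCompl (Λ := Λ) (A := B)
  obtain ⟨e⟩ := h p q hpq hp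
  rcases eq_or_ne q ⊥ with rfl | hq
  · have : p = ⊤ := by simpa using hpq.sup_eq_top
    subst this
    exact ⟨e.trans Submodule.topEquiv⟩
  · exfalso
    have := Submodule.nontrivial_iff_ne_bot.2 hq
    obtain ⟨p', q', hpq', hp'⟩ := exists_isIndecomposable_isCompl (Λ := Λ) (A := q)
    have hj : IsSplitMono p'.subtype := ⟨p'.projectionOnto q' hpq', by ext; simp⟩
    let E : (p × q) ≃ₗ[Λ] B := Submodule.prodEquivOfIsCompl p q hpq
    have hq' : IsSplitMono ((E : (p × q) →ₗ[Λ] B) ∘ₗ LinearMap.inr Λ p q ∘ₗ p'.subtype) :=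
      E.isSplitMono.comp (isSplitMono_inr.comp hj)
    have hind := hp'.of_linearEquiv (LinearEquiv.ofInjective _ hq'.injective)
    obtain ⟨r, hr⟩ := hq'
    obtain ⟨e'⟩ := h _ _ (isCompl_range_ker_of_comp_eq_id hr) hind
    let e'' := e'.trans (LinearEquiv.ofInjective _ (IsSplitMono.injective ⟨r, hr⟩)).symm
    exact h2 ⟨_, E.isSplitMono.comp (e.isSplitMono.prodMap (hj.comp e''.isSplitMono))⟩

end Split

/-! ### Almost split sequences and irreducible maps -/

section AlmostSplit

variable {Λ : Type u} [Ring Λ]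
variable {A : Type u} [AddCommGroup A] [Module Λ A]
variable {B : Type u} [AddCommGroup B] [Module Λ B]
variable {C : Type u} [AddCommGroup C] [Module Λ C]
variable {X : Type u} [AddCommGroup X] [Module Λ X]
variable {Y : Type u} [AddCommGroup Y] [Module Λ Y]

theorem exists_comp_eq_of_exact {f : A →ₗ[Λ] B} {g : B →ₗ[Λ] C} (hf : Function.Injective f)
    (hfg : Function.Exact f g) {t : X →ₗ[Λ] B} (ht : g ∘ₗ t = 0) :
    ∃ a : X →ₗ[Λ] A, f ∘ₗ a = t := by
  have hr : ∀ x, t x ∈ LinearMap.range f := fun x =>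
    (hfg (t x)).1 (LinearMap.congr_fun ht x)
  refine ⟨(LinearEquiv.ofInjective f hf).symm ∘ₗ t.codRestrict _ hr, ?_⟩
  ext x
  exact congrArg Subtype.val
    ((LinearEquiv.ofInjective f hf).apply_symm_apply (t.codRestrict _ hr x))

theorem exists_eq_comp_of_exact {f : A →ₗ[Λ] B} {g : B →ₗ[Λ] C} (hg : Function.Surjective g)
    (hfg : Function.Exact f g) {t : B →ₗ[Λ] X} (ht : t ∘ₗ f = 0) :
    ∃ c : C →ₗ[Λ] X, c ∘ₗ g = t := by
  have hker : LinearMap.ker g ≤ LinearMap.ker t := fun x hx => by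
    obtain ⟨y, rfl⟩ := (hfg x).1 hx
    exact LinearMap.congr_fun ht y
  refine ⟨(LinearMap.ker g).liftQ t hker ∘ₗ (g.quotKerEquivOfSurjective hg).symm, ?_⟩
  ext x
  have : (g.quotKerEquivOfSurjective hg).symm (g x) = (LinearMap.ker g).mkQ x := by
    rw [LinearEquiv.symm_apply_eq]
    rfl
  simp [this]

/-- An endomorphism of an exact sequence whose outer components are bijective is bijective. -/
theorem bijective_of_exact {f : A →ₗ[Λ] B} {g : B →ₗ[Λ] C} (hf : Function.Injective f)
    (hfg : Function.Exact f g) (hg : Function.Surjective g) {a : A →ₗ[Λ] A} {h : B →ₗ[Λ] B}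
    {c : C →ₗ[Λ] C} (ha : Function.Bijective a) (hc : Function.Bijective c)
    (hl : h ∘ₗ f = f ∘ₗ a) (hr : g ∘ₗ h = c ∘ₗ g) : Function.Bijective h := by
  have hl' : ∀ x, h (f x) = f (a x) := LinearMap.congr_fun hl
  have hr' : ∀ x, g (h x) = c (g x) := LinearMap.congr_fun hr
  constructor
  · rw [← LinearMap.ker_eq_bot, eq_bot_iff]
    intro x hx
    rw [LinearMap.mem_ker] at hx
    have h1 : g x = 0 := hc.1 (by rw [← hr', hx, map_zero, map_zero])
    obtain ⟨y, rfl⟩ := (hfg x).1 h1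
    have h2 : y = 0 := ha.1 (hf (by rw [← hl', hx, map_zero, map_zero]))
    simp [h2]
  · intro y
    obtain ⟨z, hz⟩ := hc.2 (g y)
    obtain ⟨x, rfl⟩ := hg z
    have h1 : g (y - h x) = 0 := by rw [map_sub, hr', hz, sub_self]
    obtain ⟨w, hw⟩ := (hfg _).1 h1
    obtain ⟨v, rfl⟩ := ha.2 w
    exact ⟨f v + x, by rw [map_add, hl', hw, sub_add_cancel]⟩

theorem IsARSequence.isRightMinimal [IsNoetherian Λ A] [IsArtinian Λ A] {f : A →ₗ[Λ] B}
    {g : B →ₗ[Λ] C} (h : IsARSequence f g) (hA : IsIndecomposable Λ A) : IsRightMinimal g := by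
  intro φ hφ
  obtain ⟨a, ha⟩ := exists_comp_eq_of_exact h.injective h.exact (t := φ ∘ₗ f) (by
    rw [← LinearMap.comp_assoc, hφ]
    exact h.exact.linearMap_comp_eq_zero)
  rcases hA.bijective_or_isNilpotent a with hb | ⟨n, hn⟩
  · exact bijective_of_exact h.injective h.exact h.surjective hb Function.bijective_id
      (c := LinearMap.id) ha.symm hφ
  · -- if `φ` acts nilpotently on `A`, some `φ ^ n` kills `A` and yields a section of `g`
    exfalso
    have h1 : ∀ n : ℕ, (φ ^ n) ∘ₗ f = f ∘ₗ (a ^ n) ∧ g ∘ₗ (φ ^ n) = g := by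
      intro n
      induction n with
      | zero => exact ⟨rfl, rfl⟩
      | succ n ih =>
        refine ⟨?_, ?_⟩
        · calc (φ ^ (n + 1)) ∘ₗ f = (φ ^ n) ∘ₗ φ ∘ₗ f := by rw [pow_succ]; rfl
            _ = ((φ ^ n) ∘ₗ f) ∘ₗ a := by rw [← ha]; rfl
            _ = f ∘ₗ (a ^ (n + 1)) := by rw [ih.1, pow_succ]; rfl
        · calc g ∘ₗ (φ ^ (n + 1)) = (g ∘ₗ (φ ^ n)) ∘ₗ φ := by rw [pow_succ]; rfl
            _ = g := by rw [ih.2, hφ]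
    obtain ⟨s, hs⟩ := exists_eq_comp_of_exact h.surjective h.exact (t := φ ^ n) (by
      rw [(h1 n).1, hn, LinearMap.comp_zero])
    refine h.right_almost_split.1 ⟨s, ?_⟩
    rw [← LinearMap.cancel_right h.surjective, LinearMap.comp_assoc, hs, (h1 n).2]
    rfl

theorem IsARSequence.isLeftMinimal [IsNoetherian Λ C] [IsArtinian Λ C] {f : A →ₗ[Λ] B}
    {g : B →ₗ[Λ] C} (h : IsARSequence f g) (hC : IsIndecomposable Λ C) : IsLeftMinimal f := by
  intro φ hφ
  obtain ⟨c, hc⟩ := exists_eq_comp_of_exact h.surjective h.exact (t := g ∘ₗ φ) (by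
    rw [LinearMap.comp_assoc, hφ]
    exact h.exact.linearMap_comp_eq_zero)
  rcases hC.bijective_or_isNilpotent c with hb | ⟨n, hn⟩
  · exact bijective_of_exact h.injective h.exact h.surjective Function.bijective_id hb
      (a := LinearMap.id) hφ hc.symm
  · exfalso
    have h1 : ∀ n : ℕ, (φ ^ n) ∘ₗ f = f ∧ g ∘ₗ (φ ^ n) = (c ^ n) ∘ₗ g := by
      intro n
      induction n with
      | zero => exact ⟨rfl, rfl⟩
      | succ n ih =>
        refine ⟨?_, ?_⟩
        · calc (φ ^ (n + 1)) ∘ₗ f = (φ ^ n) ∘ₗ φ ∘ₗ f := by rw [pow_succ]; rfl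
            _ = f := by rw [hφ, ih.1]
        · calc g ∘ₗ (φ ^ (n + 1)) = (g ∘ₗ (φ ^ n)) ∘ₗ φ := by rw [pow_succ]; rfl
            _ = (c ^ n) ∘ₗ (c ∘ₗ g) := by rw [ih.2, hc]; rfl
            _ = (c ^ (n + 1)) ∘ₗ g := by rw [pow_succ]; rfl
    obtain ⟨r, hr⟩ := exists_comp_eq_of_exact h.injective h.exact (t := φ ^ n) (by
      rw [(h1 n).2, hn, LinearMap.zero_comp])
    refine h.left_almost_split.1 ⟨r, ?_⟩
    rw [← LinearMap.cancel_left h.injective, ← LinearMap.comp_assoc, hr, (h1 n).1]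
    rfl

/-- The restriction of a minimal right almost split map to a nonzero direct summand is
irreducible. -/
theorem IsRightAlmostSplit.isIrreducibleMap_comp [Nontrivial X] {g : B →ₗ[Λ] C}
    (hg : IsRightAlmostSplit g) (hmin : IsRightMinimal g) (hC : IsIndecomposable Λ C)
    {i : X →ₗ[Λ] B} (hi : IsSplitMono i) : IsIrreducibleMap (g ∘ₗ i) := by
  have hepi : ¬ IsSplitEpi (g ∘ₗ i) := fun h => hg.1 h.of_comp
  refine ⟨fun h => hepi (isSplitEpi_of_bijective (h.bijective_of_isIndecomposable hC)), hepi, ?_⟩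
  intro Z _ _ _ u v huv
  by_contra! hno
  obtain ⟨t, ht⟩ := hg.2 Z v hno.2
  obtain ⟨r, hr⟩ := hi
  -- replacing `i` by `t ∘ u` on the summand `X` gives an endomorphism of `B` over `C`
  have hφ : g ∘ₗ (t ∘ₗ u ∘ₗ r + (LinearMap.id - i ∘ₗ r)) = g := by
    calc g ∘ₗ (t ∘ₗ u ∘ₗ r + (LinearMap.id - i ∘ₗ r))
        = ((g ∘ₗ t) ∘ₗ u) ∘ₗ r + (g - (g ∘ₗ i) ∘ₗ r) := by
          rw [LinearMap.comp_add, LinearMap.comp_sub]; rfl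
      _ = g := by rw [ht, huv]; abel
  have hφi : (t ∘ₗ u ∘ₗ r + (LinearMap.id - i ∘ₗ r)) ∘ₗ i = t ∘ₗ u := by
    calc (t ∘ₗ u ∘ₗ r + (LinearMap.id - i ∘ₗ r)) ∘ₗ i
        = t ∘ₗ u ∘ₗ (r ∘ₗ i) + (i - i ∘ₗ (r ∘ₗ i)) := by
          rw [LinearMap.add_comp, LinearMap.sub_comp]; rfl
      _ = t ∘ₗ u := by rw [hr]; simp
  have hs := (isSplitMono_of_bijective (hmin _ hφ)).comp (⟨r, hr⟩ : IsSplitMono i)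
  rw [hφi] at hs
  exact hno.1 hs.of_comp

/-- A component of a minimal left almost split map at a nonzero direct summand is
irreducible. -/
theorem IsLeftAlmostSplit.isIrreducibleMap_comp [Nontrivial X] {f : A →ₗ[Λ] B}
    (hf : IsLeftAlmostSplit f) (hmin : IsLeftMinimal f) (hA : IsIndecomposable Λ A)
    {r : B →ₗ[Λ] X} (hr : IsSplitEpi r) : IsIrreducibleMap (r ∘ₗ f) := by
  have hmono : ¬ IsSplitMono (r ∘ₗ f) := fun h => hf.1 h.of_comp
  refine ⟨hmono, fun h => hmono (isSplitMono_of_bijective (h.bijective_of_isIndecomposable hA)), ?_⟩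
  intro Z _ _ _ u v huv
  by_contra! hno
  obtain ⟨t, ht⟩ := hf.2 Z u hno.1
  obtain ⟨i, hi⟩ := hr
  have hφ : (i ∘ₗ v ∘ₗ t + (LinearMap.id - i ∘ₗ r)) ∘ₗ f = f := by
    calc (i ∘ₗ v ∘ₗ t + (LinearMap.id - i ∘ₗ r)) ∘ₗ f
        = i ∘ₗ v ∘ₗ (t ∘ₗ f) + (f - i ∘ₗ (r ∘ₗ f)) := by
          rw [LinearMap.add_comp, LinearMap.sub_comp]; rfl
      _ = f := by rw [ht, huv]; abel
  have hφr : r ∘ₗ (i ∘ₗ v ∘ₗ t + (LinearMap.id - i ∘ₗ r)) = v ∘ₗ t := by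
    calc r ∘ₗ (i ∘ₗ v ∘ₗ t + (LinearMap.id - i ∘ₗ r))
        = ((r ∘ₗ i) ∘ₗ v) ∘ₗ t + (r - (r ∘ₗ i) ∘ₗ r) := by
          rw [LinearMap.comp_add, LinearMap.comp_sub]; rfl
      _ = v ∘ₗ t := by rw [hi]; simp
  obtain ⟨s, hs⟩ := isSplitEpi_of_bijective (hmin _ hφ)
  refine hno.2 (IsSplitEpi.of_comp (f := t) ⟨s ∘ₗ i, ?_⟩)
  rw [← hφr, ← LinearMap.comp_assoc, LinearMap.comp_assoc s _ r, hs, LinearMap.comp_id, hi]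

/-- Minimal right almost split maps are unique up to isomorphism. -/
theorem nonempty_linearEquiv_of_isRightAlmostSplit [Module.Finite Λ A] [Module.Finite Λ B]
    {g : A →ₗ[Λ] C} {g' : B →ₗ[Λ] C} (hg : IsRightAlmostSplit g) (hmin : IsRightMinimal g)
    (hg' : IsRightAlmostSplit g') (hmin' : IsRightMinimal g') : Nonempty (A ≃ₗ[Λ] B) := by
  obtain ⟨t, ht⟩ := hg'.2 A g hg.1
  obtain ⟨t', ht'⟩ := hg.2 B g' hg'.1
  have h1 : Function.Bijective (t' ∘ₗ t) :=
    hmin _ (by rw [← LinearMap.comp_assoc, ht', ht])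
  have h2 : Function.Bijective (t ∘ₗ t') :=
    hmin' _ (by rw [← LinearMap.comp_assoc, ht, ht'])
  exact ⟨LinearEquiv.ofBijective t
    ⟨Function.Injective.of_comp (f := t') h1.1, Function.Surjective.of_comp (g := t') h2.2⟩⟩

/-- An irreducible map that starts in a finitely generated module is injective or surjective,
since it factors through its image. -/
theorem IsIrreducibleMap.injective_or_surjective [Module.Finite Λ A] {f : A →ₗ[Λ] B}
    (hf : IsIrreducibleMap f) : Function.Injective f ∨ Function.Surjective f := by
  rcases hf.2.2 (LinearMap.range f) f.rangeRestrict (LinearMap.range f).subtype rfl with h | h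
  · left
    exact fun x y hxy => h.injective (Subtype.ext hxy)
  · right
    rw [← LinearMap.range_eq_top, ← Submodule.range_subtype (LinearMap.range f)]
    exact LinearMap.range_eq_top.2 h.surjective

theorem IsIrreducibleMap.congr {f : A →ₗ[Λ] B} (hf : IsIrreducibleMap f) (e : X ≃ₗ[Λ] A)
    (e' : B ≃ₗ[Λ] Y) : IsIrreducibleMap ((e' : B →ₗ[Λ] Y) ∘ₗ f ∘ₗ (e : X →ₗ[Λ] A)) := by
  obtain ⟨h1, h2, h3⟩ := hf
  have he : ∀ x, e (e.symm x) = x := e.apply_symm_apply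
  refine ⟨fun ⟨r, hr⟩ => h1 ⟨e ∘ₗ r ∘ₗ e', ?_⟩, fun ⟨s, hs⟩ => h2 ⟨e ∘ₗ s ∘ₗ e', ?_⟩, ?_⟩
  · ext x
    simpa using congrArg e (LinearMap.congr_fun hr (e.symm x))
  · ext x
    simpa using congrArg e'.symm (LinearMap.congr_fun hs (e' x))
  · intro Z _ _ _ u v huv
    have huv' : ∀ x, e' (f (e x)) = v (u x) := LinearMap.congr_fun huv
    rcases h3 Z (u ∘ₗ e.symm) (e'.symm ∘ₗ v)
      (by ext x; simp [← huv']) with ⟨r, hr⟩ | ⟨s, hs⟩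
    · refine Or.inl ⟨e.symm ∘ₗ r, ?_⟩
      ext x
      simpa using congrArg e.symm (LinearMap.congr_fun hr (e x))
    · refine Or.inr ⟨s ∘ₗ e'.symm, ?_⟩
      ext x
      simpa using congrArg e' (LinearMap.congr_fun hs (e'.symm x))

theorem IsARSequence.congr {f : A →ₗ[Λ] B} {g : B →ₗ[Λ] C} (h : IsARSequence f g)
    (e : X ≃ₗ[Λ] A) (e' : C ≃ₗ[Λ] Y) :
    IsARSequence (f ∘ₗ (e : X →ₗ[Λ] A)) ((e' : C →ₗ[Λ] Y) ∘ₗ g) where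
  injective := h.injective.comp e.injective
  surjective := e'.surjective.comp h.surjective
  exact x := by
    simp only [LinearMap.comp_apply, LinearEquiv.coe_coe, map_eq_zero_iff e' e'.injective,
      h.exact x, Set.mem_range]
    exact e.surjective.exists
  left_almost_split := by
    refine ⟨fun ⟨r, hr⟩ => h.left_almost_split.1 ⟨e ∘ₗ r, ?_⟩, fun Z _ _ _ t ht => ?_⟩
    · ext x
      simpa using congrArg e (LinearMap.congr_fun hr (e.symm x))
    · obtain ⟨t', ht'⟩ := h.left_almost_split.2 Z (t ∘ₗ e.symm) fun ⟨r, hr⟩ =>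
        ht ⟨e.symm ∘ₗ r, by
          ext x
          simpa using congrArg e.symm (LinearMap.congr_fun hr (e x))⟩
      exact ⟨t', by
        ext x
        simpa using LinearMap.congr_fun ht' (e x)⟩
  right_almost_split := by
    refine ⟨fun ⟨s, hs⟩ => h.right_almost_split.1 ⟨s ∘ₗ e', ?_⟩, fun Z _ _ _ t ht => ?_⟩
    · ext x
      simpa using congrArg e'.symm (LinearMap.congr_fun hs (e' x))
    · obtain ⟨t', ht'⟩ := h.right_almost_split.2 Z (e'.symm ∘ₗ t) fun ⟨s, hs⟩ =>
        ht ⟨s ∘ₗ e'.symm, by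
          ext x
          simpa using congrArg e' (LinearMap.congr_fun hs (e'.symm x))⟩
      exact ⟨t', by
        ext x
        simpa using congrArg e' (LinearMap.congr_fun ht' x)⟩

theorem IsARSequence.finite [Module.Finite Λ A] [Module.Finite Λ C] {f : A →ₗ[Λ] B}
    {g : B →ₗ[Λ] C} (h : IsARSequence f g) : Module.Finite Λ B := by
  refine ⟨Submodule.fg_of_fg_map_of_fg_inf_ker g ?_ ?_⟩
  · rw [Submodule.map_top, LinearMap.range_eq_top.2 h.surjective]
    exact Module.Finite.fg_top
  · rw [top_inf_eq, h.exact.linearMap_ker_eq, LinearMap.range_eq_map]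
    exact Module.Finite.fg_top.map f

end AlmostSplit

/-! ### Rays and corays of a stable tube -/

section Tube

variable {Λ : Type u} [Ring Λ]

theorem IndecMod.Arrow.congr {X X' Y Y' : IndecMod Λ} (h : X.Arrow Y) (hX : X.Iso X')
    (hY : Y.Iso Y') : X'.Arrow Y' := by
  obtain ⟨f, hf⟩ := h
  obtain ⟨e⟩ := hX
  obtain ⟨e'⟩ := hY
  exact ⟨_, hf.congr e.symm e'⟩

theorem IndecMod.IsTranslate.congr {X X' Y Y' : IndecMod Λ} (h : X.IsTranslate Y)
    (hX : X.Iso X') (hY : Y.Iso Y') : X'.IsTranslate Y' := by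
  obtain ⟨B, _, _, f, g, hfg⟩ := h
  obtain ⟨e⟩ := hX
  obtain ⟨e'⟩ := hY
  exact ⟨B, _, _, _, _, hfg.congr e.symm e'⟩

namespace StableTube

variable (T : StableTube Λ)

variable {T} in
theorem Mem.sameComponent {X : IndecMod Λ} (h : T.Mem X) : (T.obj (0, 0)).SameComponent X :=
  (T.component X).2 h

variable {T} in
theorem Mem.of_arrow {X Y : IndecMod Λ} (h : T.Mem Y) (hXY : X.Arrow Y) : T.Mem X :=
  (T.component X).1 (h.sameComponent.trans _ _ _ (.symm _ _ (.rel _ _ (Or.inr hXY))))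

variable {T} in
theorem Mem.of_arrow' {X Y : IndecMod Λ} (h : T.Mem X) (hXY : X.Arrow Y) : T.Mem Y :=
  (T.component Y).1 (h.sameComponent.trans _ _ _ (.rel _ _ (Or.inr hXY)))

theorem exists_iso_of_arrow {X : IndecMod Λ} {q : TubeVertex T.rank}
    (h : X.Arrow (T.obj q)) : ∃ p, X.Iso (T.obj p) ∧ p.Arrow q := by
  have hq : T.Mem (T.obj q) := ⟨q, ⟨.refl _ _⟩⟩
  obtain ⟨p, hp⟩ := hq.of_arrow h
  exact ⟨p, hp, (T.arrow_iff p q).1 (h.congr hp ⟨.refl _ _⟩)⟩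

variable [IsArtinianRing Λ]

/-- Since the valuation is trivial, the starting point of an arrow into `q` is a direct summand
of multiplicity one in the middle term of the almost split sequence that ends in `q`. -/
theorem exists_complement_of_arrow {X : IndecMod Λ} {p q : TubeVertex T.rank} (hpq : p.Arrow q)
    {B : Type u} [AddCommGroup B] [Module Λ B] {f : X →ₗ[Λ] B} {g : B →ₗ[Λ] T.obj q}
    (h : IsARSequence f g) :
    ∃ (Z : Type u) (_ : AddCommGroup Z) (_ : Module Λ Z) (_ : Module.Finite Λ Z),
      (T.obj p).NotSummand Z ∧ Nonempty (B ≃ₗ[Λ] T.obj p × Z) := by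
  obtain ⟨⟨Z, _, _, _, g', hZ, hmin, has⟩, -⟩ := T.valuation p q hpq
  have := h.finite
  obtain ⟨e⟩ := nonempty_linearEquiv_of_isRightAlmostSplit h.right_almost_split
    (h.isRightMinimal X.indecomposable) has hmin
  exact ⟨Z, _, _, ‹_›, hZ,
    ⟨e.trans ((LinearEquiv.funUnique (Fin 1) Λ (T.obj p)).prodCongr (.refl _ _))⟩⟩

theorem not_isSplitMono_prod_of_arrow {X : IndecMod Λ} {p q : TubeVertex T.rank}
    (hpq : p.Arrow q) {B : Type u} [AddCommGroup B] [Module Λ B] {f : X →ₗ[Λ] B}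
    {g : B →ₗ[Λ] T.obj q} (h : IsARSequence f g) (i : (T.obj p × T.obj p) →ₗ[Λ] B) :
    ¬ IsSplitMono i := by
  intro hi
  obtain ⟨Z, _, _, _, hZ, ⟨e⟩⟩ := T.exists_complement_of_arrow hpq h
  exact hZ (exists_isSplitMono_of_isSplitMono_prod (T.obj p).indecomposable
    (e.isSplitMono.comp hi))

/-- The length of the module at a vertex, as a natural number. -/
noncomputable def len (p : TubeVertex T.rank) : ℕ := (Module.length Λ (T.obj p)).toNat

theorem coe_len (p : TubeVertex T.rank) : (T.len p : ℕ∞) = Module.length Λ (T.obj p) :=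
  ENat.natCast_toNat Module.length_ne_top

theorem len_pos (p : TubeVertex T.rank) : 0 < T.len p := by
  have := (T.obj p).indecomposable.1
  rw [← Nat.cast_lt (α := ℕ∞), T.coe_len]
  exact Module.length_pos

/-- The middle term of the almost split sequence that ends in `(i + 1, j)` is the direct sum of
the module at `(i, j + 1)` and a module that, for `j = 0`, is zero, and otherwise is zero or the
module at `(i + 1, j - 1)`. -/
theorem exists_len_eq (i : ZMod T.rank) (j : ℕ) :
    ∃ z, T.len (i, j) + T.len (i + 1, j) = T.len (i, j + 1) + z ∧
      (z = 0 ∨ ∃ k, j = k + 1 ∧ z = T.len (i + 1, k)) := by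
  obtain ⟨B, _, _, f, g, h⟩ := (T.translate_iff (i, j) (i + 1, j)).2
    (by simp [TubeVertex.translate])
  have hB := h.finite
  have hmin := h.isRightMinimal (T.obj (i, j)).indecomposable
  obtain ⟨Z, _, _, _, hZ, ⟨e⟩⟩ := T.exists_complement_of_arrow (p := (i, j + 1))
    (Or.inr ⟨rfl, rfl⟩) h
  have hZtop : Module.length Λ Z ≠ ⊤ := Module.length_ne_top
  refine ⟨(Module.length Λ Z).toNat, ?_, ?_⟩
  · rw [← Nat.cast_inj (R := ℕ∞)]
    push_cast
    rw [ENat.natCast_toNat hZtop, T.coe_len, T.coe_len, T.coe_len,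
      ← Module.length_eq_add_of_exact f g h.injective h.surjective h.exact, e.length_eq,
      Module.length_prod]
  -- an indecomposable summand of `Z` sits on an arrow that does not start in `(i, j + 1)`
  have key : ∀ p q : Submodule Λ Z, IsCompl p q → IsIndecomposable Λ p →
      ∃ k, j = k + 1 ∧ Nonempty (T.obj (i + 1, k) ≃ₗ[Λ] p) := by
    intro p q hpq hp
    have hs : IsSplitMono p.subtype := ⟨p.projectionOnto q hpq, by ext; simp⟩
    have := hp.1
    let P : IndecMod Λ := ⟨p, hp⟩
    obtain ⟨v, ⟨ev⟩, hv⟩ := T.exists_iso_of_arrow (X := P) ⟨_,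
      h.right_almost_split.isIrreducibleMap_comp hmin (T.obj (i + 1, j)).indecomposable
        (e.symm.isSplitMono.comp (isSplitMono_inr.comp hs))⟩
    obtain ⟨v1, v2⟩ := v
    rcases hv with hv | ⟨hv1, hv2⟩
    · obtain ⟨rfl, rfl⟩ := Prod.mk.inj hv
      exact ⟨v2, rfl, ⟨ev.symm⟩⟩
    · obtain rfl : i = v1 := add_right_cancel hv1
      simp only at hv2
      subst hv2
      exact (hZ ⟨_, hs.comp ev.symm.isSplitMono⟩).elim
  rcases j with _ | k
  · left
    suffices Subsingleton Z by simp
    rw [← not_nontrivial_iff_subsingleton]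
    intro hnt
    obtain ⟨p, q, hpq, hp⟩ := exists_isIndecomposable_isCompl (Λ := Λ) (A := Z)
    obtain ⟨k, hk, -⟩ := key p q hpq hp
    omega
  · have hsum : ∀ p q : Submodule Λ Z, IsCompl p q → IsIndecomposable Λ p →
        Nonempty (T.obj (i + 1, k) ≃ₗ[Λ] p) := by
      intro p q hpq hp
      obtain ⟨k', hk, hk'⟩ := key p q hpq hp
      obtain rfl : k = k' := by omega
      exact hk'
    have hmult : ¬ ∃ w : (T.obj (i + 1, k) × T.obj (i + 1, k)) →ₗ[Λ] Z, IsSplitMono w := by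
      rintro ⟨w, hw⟩
      exact T.not_isSplitMono_prod_of_arrow (p := (i + 1, k)) (Or.inl rfl) h _
        (e.symm.isSplitMono.comp (isSplitMono_inr.comp hw))
    rcases subsingleton_or_nonempty_linearEquiv hsum hmult with hsub | hez
    · left
      simp
    · obtain ⟨ez⟩ := hez
      exact Or.inr ⟨k, rfl, by rw [← ez.length_eq, len]⟩

/-- Following the arrows, lengths increase strictly along rays and decrease strictly along
corays. -/
theorem len_lt_len (i : ZMod T.rank) (j : ℕ) :
    T.len (i, j) < T.len (i, j + 1) ∧ T.len (i + 1, j) < T.len (i, j + 1) := by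
  induction j generalizing i with
  | zero =>
    obtain ⟨z, hz, rfl | ⟨k, hk, -⟩⟩ := T.exists_len_eq i 0
    · have h1 := T.len_pos (i, 0)
      have h2 := T.len_pos (i + 1, 0)
      omega
    · omega
  | succ j ih =>
    have h1 := T.len_pos (i, j + 1)
    have h2 := T.len_pos (i + 1, j + 1)
    have h3 := (ih (i + 1)).1
    have h4 := (ih i).2
    obtain ⟨z, hz, rfl | ⟨k, hk, rfl⟩⟩ := T.exists_len_eq i (j + 1)
    · omega
    · obtain rfl : j = k := by omega
      omega

theorem exists_injective (i : ZMod T.rank) (j : ℕ) :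
    ∃ φ : T.obj (i, j) →ₗ[Λ] T.obj (i, j + 1), Function.Injective φ := by
  obtain ⟨φ, hφ⟩ := (T.arrow_iff (i, j) (i, j + 1)).2 (Or.inl rfl)
  refine ⟨φ, hφ.injective_or_surjective.resolve_right fun h => ?_⟩
  have := Module.length_le_of_surjective φ h
  rw [← T.coe_len, ← T.coe_len, Nat.cast_le] at this
  exact this.not_gt (T.len_lt_len i j).1

theorem exists_surjective (i : ZMod T.rank) (j : ℕ) :
    ∃ φ : T.obj (i, j + 1) →ₗ[Λ] T.obj (i + 1, j), Function.Surjective φ := by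
  obtain ⟨φ, hφ⟩ := (T.arrow_iff (i, j + 1) (i + 1, j)).2 (Or.inr ⟨rfl, rfl⟩)
  refine ⟨φ, hφ.injective_or_surjective.resolve_left fun h => ?_⟩
  have := Module.length_le_of_injective φ h
  rw [← T.coe_len, ← T.coe_len, Nat.cast_le] at this
  exact this.not_gt (T.len_lt_len i j).2

/-! ### Rhombic limits -/

/-- The limit of the Gabriel-Roiter measures along the ray that starts in `(i, 0)`. -/
noncomputable def rayLimit (i : ZMod T.rank) : GRSeq :=
  sSup (Set.range fun j : ℕ => grMeasure Λ (T.obj (i, j)))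

/-- The limit of the Gabriel-Roiter comeasures along the coray that ends in `(c, 0)`. -/
noncomputable def corayLimit (c : ZMod T.rank) : GRSeqᵒᵈ :=
  sInf (Set.range fun j : ℕ => grComeasure Λ (T.obj (c - j, j)))

theorem tendsto_rayLimit (i : ZMod T.rank) :
    Filter.Tendsto (fun j : ℕ => grMeasure Λ (T.obj (i, j))) Filter.atTop
      (nhds (T.rayLimit i)) := by
  refine tendsto_atTop_isLUB (monotone_nat_of_le_succ fun j => ?_) (GRSeq.isLUB_sSup _)
  obtain ⟨φ, hφ⟩ := T.exists_injective i j
  exact grMeasure_le_of_injective φ hφ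

theorem tendsto_corayLimit (c : ZMod T.rank) :
    Filter.Tendsto (fun j : ℕ => grComeasure Λ (T.obj (c - j, j))) Filter.atTop
      (nhds (T.corayLimit c)) := by
  -- an infimum in the opposite order is a supremum
  have hglb : IsGLB (Set.range fun j : ℕ => grComeasure Λ (T.obj (c - j, j))) (T.corayLimit c) :=
    (GRSeq.isLUB_sSup (OrderDual.toDual ⁻¹'
      (Set.range fun j : ℕ => grComeasure Λ (T.obj (c - j, j))))).dual
  refine tendsto_atTop_isGLB (antitone_nat_of_succ_le fun j => ?_) hglb
  obtain ⟨φ, hφ⟩ := T.exists_surjective (c - (j + 1 : ℕ)) j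
  have hc : c - (j + 1 : ℕ) + 1 = c - j := by
    push_cast
    ring
  rw [← hc]
  exact grComeasure_le_of_surjective φ hφ

/-- The rhombic limit of a module in the tube exists. Its first coordinate depends only on the
ray and its second coordinate only on the coray of the module. -/
theorem isRhombicLimit {M : IndecMod Λ} {p : TubeVertex T.rank} (h : M.Iso (T.obj p)) :
    T.IsRhombicLimit M (T.rayLimit p.1, T.corayLimit (p.1 + p.2)) := by
  -- the family of `(i, j)` consists of the vertices `(i, j % n + k * n)`
  have hs : StrictMono fun k : ℕ => p.2 % T.rank + k * T.rank := fun k l hkl =>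
    Nat.add_lt_add_left (Nat.mul_lt_mul_of_pos_right hkl T.rank_pos) _
  have hcast : ∀ k : ℕ, ((p.2 % T.rank + k * T.rank : ℕ) : ZMod T.rank) = p.2 := by
    intro k
    simp
  refine ⟨p, fun k => (p.1, p.2 % T.rank + k * T.rank), h, ⟨?_, ?_⟩, ?_⟩
  · ext ⟨q1, q2⟩
    simp only [Set.mem_range, Prod.mk.injEq, Set.mem_inter_iff, TubeVertex.ray, TubeVertex.coray,
      Set.mem_ofPred_eq]
    constructor
    · rintro ⟨k, rfl, rfl⟩
      exact ⟨rfl, by rw [hcast]⟩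
    · rintro ⟨rfl, hq⟩
      have hq' := (ZMod.natCast_eq_natCast_iff' _ _ _).1 (add_left_cancel hq)
      exact ⟨q2 / T.rank, rfl, by rw [← hq', Nat.mod_add_div']⟩
  · have hl : StrictMono fun j => T.len (p.1, j) :=
      strictMono_nat_of_lt_succ fun j => (T.len_lt_len p.1 j).1
    intro k l hkl
    simp only [← T.coe_len, Nat.cast_lt]
    exact hl (hs hkl)
  · have h1 := (T.tendsto_rayLimit p.1).comp hs.tendsto_atTop
    have h2 := (T.tendsto_corayLimit (p.1 + p.2)).comp hs.tendsto_atTop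
    refine h1.prodMk_nhds (h2.congr fun k => ?_)
    simp only [Function.comp_apply]
    rw [hcast, add_sub_cancel_right]

/-- In an almost split sequence of the tube with two indecomposable middle terms, these are, up
to isomorphism and order, the modules at the two vertices adjacent to both ends. -/
theorem exists_vertices_of_isARSequence {A B₁ B₂ C : IndecMod Λ} {f : A →ₗ[Λ] (B₁ × B₂)}
    {g : (B₁ × B₂) →ₗ[Λ] C} (hfg : IsARSequence f g) (hA : T.Mem A) :
    ∃ (i : ZMod T.rank) (k : ℕ), A.Iso (T.obj (i, k + 1)) ∧ C.Iso (T.obj (i + 1, k + 1)) ∧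
      ((B₁.Iso (T.obj (i, k + 2)) ∧ B₂.Iso (T.obj (i + 1, k))) ∨
        (B₂.Iso (T.obj (i, k + 2)) ∧ B₁.Iso (T.obj (i + 1, k)))) := by
  have := B₁.indecomposable.1
  have := B₂.indecomposable.1
  have hfmin := hfg.isLeftMinimal C.indecomposable
  have hgmin := hfg.isRightMinimal A.indecomposable
  have hAB : A.Arrow B₁ := ⟨_, hfg.left_almost_split.isIrreducibleMap_comp hfmin
    A.indecomposable (r := LinearMap.fst Λ B₁ B₂) ⟨LinearMap.inl Λ B₁ B₂, by ext; simp⟩⟩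
  have hB1 : B₁.Arrow C := ⟨_, hfg.right_almost_split.isIrreducibleMap_comp hgmin
    C.indecomposable isSplitMono_inl⟩
  have hB2 : B₂.Arrow C := ⟨_, hfg.right_almost_split.isIrreducibleMap_comp hgmin
    C.indecomposable isSplitMono_inr⟩
  obtain ⟨q, hq⟩ := (hA.of_arrow' hAB).of_arrow' hB1
  obtain ⟨⟨i, j⟩, hp⟩ := hA
  have hpq : (i, j) = q.translate := (T.translate_iff _ _).1
    (IndecMod.IsTranslate.congr (Y := C) ⟨_, _, _, f, g, hfg⟩ hp hq)
  obtain rfl : q = (i + 1, j) := by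
    obtain ⟨h1, h2⟩ := Prod.mk.inj hpq
    exact Prod.ext (by rw [h1]; ring) h2.symm
  obtain ⟨v₁, hv₁, ha₁⟩ := T.exists_iso_of_arrow (hB1.congr ⟨.refl _ _⟩ hq)
  obtain ⟨v₂, hv₂, ha₂⟩ := T.exists_iso_of_arrow (hB2.congr ⟨.refl _ _⟩ hq)
  -- the multiplicity of each middle term is one
  have hne : v₁ ≠ v₂ := by
    rintro rfl
    obtain ⟨e⟩ := hq
    obtain ⟨e₁⟩ := hv₁
    obtain ⟨e₂⟩ := hv₂
    exact T.not_isSplitMono_prod_of_arrow ha₁ (hfg.congr (.refl _ _) e) _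
      (e₁.prodCongr e₂).symm.isSplitMono
  have hv : ∀ v : TubeVertex T.rank, v.Arrow (i + 1, j) →
      v = (i, j + 1) ∨ ∃ k, j = k + 1 ∧ v = (i + 1, k) := by
    rintro ⟨v1, v2⟩ (h | ⟨h1, h2⟩)
    · obtain ⟨rfl, rfl⟩ := Prod.mk.inj h
      exact Or.inr ⟨v2, rfl, rfl⟩
    · exact Or.inl (Prod.ext (add_right_cancel h1).symm h2)
  rcases hv v₁ ha₁ with rfl | ⟨k, rfl, rfl⟩
  · rcases hv v₂ ha₂ with rfl | ⟨k, rfl, rfl⟩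
    · exact absurd rfl hne
    · exact ⟨i, k, hp, hq, Or.inl ⟨hv₁, hv₂⟩⟩
  · rcases hv v₂ ha₂ with rfl | ⟨k', hk, rfl⟩
    · exact ⟨i, k, hp, hq, Or.inr ⟨hv₂, hv₁⟩⟩
    · obtain rfl : k = k' := by omega
      exact absurd rfl hne

end StableTube

end Tube

end RhombicTube

theorem mainTheorem6
    {R : Type*} [CommRing R] [IsArtinianRing R]
    {Λ : Type u} [Ring Λ] [Algebra R Λ] [Module.Finite R Λ]
    (T : RhombicTube.StableTube Λ)
    (A B₁ B₂ C : RhombicTube.IndecMod Λ)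
    (f : A →ₗ[Λ] (B₁ × B₂)) (g : (B₁ × B₂) →ₗ[Λ] C)
    (hfg : RhombicTube.IsARSequence f g) (hA : T.Mem A) :
    ∃ a b₁ b₂ c : RhombicTube.GRSeq × RhombicTube.GRSeqᵒᵈ,
      T.IsRhombicLimit A a ∧ T.IsRhombicLimit B₁ b₁ ∧
      T.IsRhombicLimit B₂ b₂ ∧ T.IsRhombicLimit C c ∧
      RhombicTube.IsAxisParallelogram a b₁ b₂ c := by
  have : IsArtinianRing Λ := IsArtinianRing.of_finite R Λ
  obtain ⟨i, k, h1, h2, h3⟩ := T.exists_vertices_of_isARSequence hfg hA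
  -- `(i, k + 1)` and `(i + 1, k)` lie on the coray that ends in `(i + k + 1, 0)`, while
  -- `(i, k + 2)` and `(i + 1, k + 1)` lie on the one that ends in `(i + k + 2, 0)`
  have e1 : i + ((k + 1 : ℕ) : ZMod T.rank) = i + 1 + (k : ZMod T.rank) := by
    push_cast
    ring
  have e2 : i + ((k + 2 : ℕ) : ZMod T.rank) = i + 1 + ((k + 1 : ℕ) : ZMod T.rank) := by
    push_cast
    ring
  rcases h3 with ⟨h3, h4⟩ | ⟨h3, h4⟩
  · exact ⟨_, _, _, _, T.isRhombicLimit h1, T.isRhombicLimit h3, T.isRhombicLimit h4,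
      T.isRhombicLimit h2, Or.inl ⟨⟨rfl, rfl⟩, congrArg T.corayLimit e1,
        congrArg T.corayLimit e2⟩⟩
  · exact ⟨_, _, _, _, T.isRhombicLimit h1, T.isRhombicLimit h4, T.isRhombicLimit h3,
      T.isRhombicLimit h2, Or.inr ⟨⟨rfl, rfl⟩, congrArg T.corayLimit e1,
        congrArg T.corayLimit e2⟩⟩
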